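/- Let $M, d_1,\dots,d_M\in\mathbb{N}$ and, for $i=1,\dots,M$, let $\Omega_i\subset\mathbb{R}^{d_i}$ and let $K_i:\mathbb{R}^{d_i}\times\mathbb{R}^{d_i}\to\mathbb{R}$ be a positive semi-definite kernel (i.e. for all finitely many pairwise distinct points $x_1,\dots,x_n$ the matrix $(K_i(x_j,x_k))_{j,k}$ is symmetric and positive semi-definite). Let $\Omega=\Omega_1\times\dots\times\Omega_M\subset\mathbb{R}^{d_1}\times\dots\times\mathbb{R}^{d_M}\simeq\mathbb{R}^{d}$, $d=\sum_i d_i$, and let $K(x,y)=\prod_{i=1}^M K_i(x^i,y^i)$ be the product kernel, where $x^i$ denotes the $i$-th component of $x$. For a positive semi-definite kernel $L$ and a subset $S$ of its domain, let $\mathcal{H}_{L,S}$ denote the native space, i.e. the reproducing kernel Hilbert space of real functions on $S$ with reproducing kernel $L|_{S\times S}$. A Hilbert tensor product of real Hilbert spaces $\mathcal{H}_1,\dots,\mathcal{H}_M$ is a pair $(\mathcal{H},\varphi)$ of a real Hilbert space $\mathcal{H}$ and a multilinear map $\varphi:\mathcal{H}_1\times\dots\times\mathcal{H}_M\to\mathcal{H}$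 such that $$\langle\varphi(x_1,\dots,x_M),\varphi(y_1,\dots,y_M)\rangle_{\mathcal{H}}=\prod_{i=1}^M\langle x_i,y_i\rangle_{\mathcal{H}_i}$$ for all $x_i,y_i\in\mathcal{H}_i$, and such that the linear span of the range of $\varphi$ is dense in $\mathcal{H}$. Then the map $$\varphi:\mathcal{H}_{K_1,\Omega_1}\times\dots\times\mathcal{H}_{K_M,\Omega_M}\to\mathcal{H}_{K,\Omega},\qquad \varphi(f_1,\dots,f_M)(x)=\prod_{i=1}^M f_i(x^i)\quad(x\in\Omega),$$ is well defined and multilinear, and $(\mathcal{H}_{K,\Omega},\varphi)$ is a Hilbert tensor product of $\mathcal{H}_{K_1,\Omega_1},\dots,\mathcal{H}_{K_M,\Omega_M}$. Moreover, for every Hilbert tensor product $(T,\psi)$ of these spaces there is a linear isometric isomorphism $U:T\to\mathcal{H}_{K,\Omega}$ with $U\circ\psi=\varphi$. -/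

import Mathlib

noncomputable section

/-- The interpolation matrix `A_{K,X} = (K (x_i) (x_j))_{i,j}` of a kernel `K` at the points
`x_1, …, x_n`. -/
def interpolationMatrix {X : Type*} (K : X → X → ℝ) {n : ℕ} (x : Fin n → X) :
    Matrix (Fin n) (Fin n) ℝ :=
  Matrix.of fun i j => K (x i) (x j)

/-- A kernel is positive semi-definite if, for any finitely many pairwise distinct points, the
interpolation matrix is symmetric and positive semi-definite (over `ℝ`, Mathlib's
`Matrix.PosSemidef` contains the symmetry). -/
def IsPosSemidefKernel {X : Type*} (K : X → X → ℝ) : Prop :=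
  ∀ (n : ℕ) (x : Fin n → X), Function.Injective x → (interpolationMatrix K x).PosSemidef

/-- The positive semi-definite kernels on `X`. -/
structure PosSemidefKernel (X : Type*) where
  /-- The underlying function of two variables. -/
  toFun : X → X → ℝ
  /-- Positive semi-definiteness. -/
  posSemidef : IsPosSemidefKernel toFun

/-- The kernel, seen as an `X × X` matrix, is positive semi-definite in Mathlib's sense. -/
theorem isPosSemidefKernel_iff {X : Type*} (K : X → X → ℝ) :
    IsPosSemidefKernel K ↔ (Matrix.of K).PosSemidef := by
  constructor
  · intro h
    have key : ∀ s : Finset X, ((Matrix.of K).submatrix (Subtype.val : s → X)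
        (Subtype.val : s → X)).PosSemidef := by
      intro s
      have := h _ (fun i => ((s.equivFin.symm i : s) : X))
        (Subtype.val_injective.comp s.equivFin.symm.injective)
      have h2 := this.submatrix s.equivFin
      convert h2 using 1
      ext i j
      simp [interpolationMatrix]
    refine ⟨?_, fun c => ?_⟩
    · classical
      ext x y
      have := (key {x, y}).1.apply ⟨x, by simp⟩ ⟨y, by simp⟩
      simpa using this
    · have := (Matrix.posSemidef_iff_dotProduct_mulVec.mp (key c.support)).2 (fun i => c i)
      convert this using 1
      simp only [Finsupp.sum, dotProduct, Matrix.mulVec, Matrix.submatrix_apply, Finset.mul_sum,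
        Pi.star_apply]
      rw [← Finset.sum_coe_sort]
      refine Finset.sum_congr rfl fun i _ => ?_
      rw [← Finset.sum_coe_sort]
      refine Finset.sum_congr rfl fun j _ => ?_
      ring
  · intro h n x _
    exact h.submatrix x

namespace PosSemidefKernel

/-- The restriction of a positive semi-definite kernel to a subset `Ω`. -/
def restrict {X : Type*} (K : PosSemidefKernel X) (Ω : Set X) : PosSemidefKernel Ω where
  toFun x y := K.toFun x y
  posSemidef n x hx := K.posSemidef n (fun i => (x i : X)) (Subtype.val_injective.comp hx)

/-- The product kernel `K (x, y) = ∏ i, K_i (x^i, y^i)` on the Cartesian product, where `x^i` is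
the `i`-th projection `x i` of `x`. -/
def prod {ι : Type*} [Fintype ι] {X : ι → Type*} (K : ∀ i, PosSemidefKernel (X i)) :
    PosSemidefKernel (∀ i, X i) where
  toFun x y := ∏ i, (K i).toFun (x i) (y i)
  posSemidef := by
    classical
    rw [isPosSemidefKernel_iff]
    suffices H : ∀ s : Finset ι, (Matrix.of fun x y : ∀ i, X i =>
        ∏ i ∈ s, (K i).toFun (x i) (y i)).PosSemidef from H Finset.univ
    intro s
    induction s using Finset.induction_on with
    | empty =>
      rw [← isPosSemidefKernel_iff]
      intro n x _
      have : interpolationMatrix (fun x y : ∀ i, X i =>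
          ∏ i ∈ (∅ : Finset ι), (K i).toFun (x i) (y i)) x =
          Matrix.vecMulVec (fun _ => (1 : ℝ)) (star fun _ => (1 : ℝ)) := by
        ext i j
        simp [interpolationMatrix, Matrix.vecMulVec]
      rw [this]
      exact Matrix.posSemidef_vecMulVec_self_star _
    | insert a s ha ih =>
      have h1 := ((isPosSemidefKernel_iff _).1 (K a).posSemidef).submatrix
        (fun x : ∀ i, X i => x a)
      have h2 := h1.hadamard ih
      have e : (Matrix.of fun x y : ∀ i, X i => ∏ i ∈ insert a s, (K i).toFun (x i) (y i)) =
          ((Matrix.of (K a).toFun).submatrix (fun x : ∀ i, X i => x a) fun x => x a).hadamard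
            (Matrix.of fun x y => ∏ i ∈ s, (K i).toFun (x i) (y i)) := by
        ext x y
        simp [Finset.prod_insert ha]
      rw [e]
      exact h2

/-- A scalar kernel as an operator-valued matrix: the value `K x y` acts on `ℝ` by
multiplication. This is the format of kernels in Mathlib's theory of (vector-valued) reproducing
kernel Hilbert spaces. -/
def opMatrix {X : Type*} (K : PosSemidefKernel X) : Matrix X X (ℝ →L[ℝ] ℝ) :=
  Matrix.of fun x y => K.toFun x y • ContinuousLinearMap.id ℝ ℝ

instance factPosSemidefOpMatrix {X : Type*} (K : PosSemidefKernel X) :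
    Fact K.opMatrix.PosSemidef := by
  have hK := (isPosSemidefKernel_iff _).1 K.posSemidef
  constructor
  have tfae := (RKHS.posSemidef_tfae (K := K.opMatrix)).out 0 2
  refine tfae.2 ⟨?_, fun v => ?_⟩
  · ext x y
    have := hK.1.apply x y
    simp only [Matrix.of_apply, star_trivial] at this
    have h1 : star (ContinuousLinearMap.id ℝ ℝ) = ContinuousLinearMap.id ℝ ℝ :=
      star_one (ℝ →L[ℝ] ℝ)
    simp [opMatrix, this, h1]
  · have := hK.2 v
    refine this.trans_eq ?_
    simp only [Finsupp.sum, RCLike.re_to_real]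
    rw [Finset.sum_comm]
    refine Finset.sum_congr rfl fun i _ => Finset.sum_congr rfl fun j _ => ?_
    simp [opMatrix, mul_assoc]

/-- The native space `𝓗_{K,Ω}`: the reproducing kernel Hilbert space of functions `Ω → ℝ`
generated by the restriction of `K` to `Ω`, that is, Mathlib's (Hausdorff) completion of the finite
linear combinations of the kernel functions `K (·, x)`, `x ∈ Ω`, under the inner product with
`⟨K (·, x), K (·, y)⟩ = K (x, y)`. Its elements act as functions on `Ω`: for
`f : K.NativeSpace Ω` and `x : Ω`, the value is `f x`. -/
abbrev NativeSpace {X : Type*} (K : PosSemidefKernel X) (Ω : Set X) : Type _ :=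
  RKHS.OfKernel (K.restrict Ω).opMatrix

end PosSemidefKernel

/-- `(T, φ)` is a Hilbert tensor product of the real Hilbert spaces `H i`: `T` is a real Hilbert
space, `φ` is multilinear, inner products of tensors are the products of the component inner
products, and the tensors span a dense subspace. -/
structure IsHilbertTensorProduct {ι : Type*} [Fintype ι] {H : ι → Type*}
    [∀ i, NormedAddCommGroup (H i)] [∀ i, InnerProductSpace ℝ (H i)] [∀ i, CompleteSpace (H i)]
    {T : Type*} [NormedAddCommGroup T] [InnerProductSpace ℝ T] [CompleteSpace T]
    (φ : MultilinearMap ℝ H T) : Prop where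
  inner_map_map : ∀ x y : ∀ i, H i, inner ℝ (φ x) (φ y) = ∏ i, inner ℝ (x i) (y i)
  dense_span : Dense (Submodule.span ℝ (Set.range φ) : Set T)

end

/-!
Let `v` and `w` be families of vectors of two Hilbert spaces, indexed by the same set. There is an
operator of norm at most `C` mapping each `v x` to `w x` exactly when the Gram matrix of `w` is
dominated by `C ^ 2` times the Gram matrix of `v`. For the kernel functions `v x = K (·, x)` of a
reproducing kernel Hilbert space and scalars `w x = F x`, this says that `F` belongs to the space,
with norm at most `C`, if and only if the rank one kernel `F x * F y` is dominated by
`C ^ 2 * K x y`. By the Schur product theorem such dominations can be multiplied entrywise, so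
pointwise products of functions in the factor spaces lie in the space of the product kernel, with
norm at most the product of the norms. The resulting multilinear map is therefore continuous, and
the formula for inner products only has to be checked on the kernel functions, where it is the
definition of the product kernel.
-/

open scoped InnerProductSpace

section GramMatrix

open Matrix
open scoped ComplexOrder MatrixOrder

variable {𝕜 X E F : Type*} [RCLike 𝕜]

theorem sum_star_mul_gram_mul [SeminormedAddCommGroup E] [InnerProductSpace 𝕜 E] (v : X → E)
    (c : X →₀ 𝕜) :
    (c.sum fun x a => c.sum fun y b => star a * gram 𝕜 v x y * b) =
      (‖Finsupp.linearCombination 𝕜 v c‖ : 𝕜) ^ 2 := by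
  simp only [← inner_self_eq_norm_sq_to_K, Finsupp.linearCombination_apply, Finsupp.sum, sum_inner,
    inner_sum, inner_smul_left, inner_smul_right, gram_apply, RCLike.star_def]
  rw [Finset.sum_comm]
  refine Finset.sum_congr rfl fun x _ => ?_
  rw [Finset.mul_sum]
  refine Finset.sum_congr rfl fun y _ => ?_
  ring

theorem gram_nonneg [SeminormedAddCommGroup E] [InnerProductSpace 𝕜 E] (v : X → E) :
    0 ≤ gram 𝕜 v := by
  refine nonneg_iff_posSemidef.2 ⟨isHermitian_gram 𝕜 v, fun c => ?_⟩
  rw [sum_star_mul_gram_mul]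
  positivity

variable [NormedAddCommGroup E] [InnerProductSpace 𝕜 E] [NormedAddCommGroup F]
  [InnerProductSpace 𝕜 F] {v : X → E} {w : X → F}

theorem norm_linearCombination_le_of_gram_le {C : ℝ} (hC : 0 ≤ C)
    (h : gram 𝕜 w ≤ C ^ 2 • gram 𝕜 v) (c : X →₀ 𝕜) :
    ‖Finsupp.linearCombination 𝕜 w c‖ ≤ C * ‖Finsupp.linearCombination 𝕜 v c‖ := by
  have hform : (c.sum fun x a => c.sum fun y b => star a * (C ^ 2 • gram 𝕜 v - gram 𝕜 w) x y * b) =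
      (C : 𝕜) ^ 2 * (‖Finsupp.linearCombination 𝕜 v c‖ : 𝕜) ^ 2 -
        (‖Finsupp.linearCombination 𝕜 w c‖ : 𝕜) ^ 2 := by
    simp only [← sum_star_mul_gram_mul, Finsupp.sum, Finset.mul_sum, ← Finset.sum_sub_distrib]
    refine Finset.sum_congr rfl fun x _ => Finset.sum_congr rfl fun y _ => ?_
    simp only [Matrix.sub_apply, Matrix.smul_apply, RCLike.real_smul_eq_coe_mul, RCLike.ofReal_pow]
    ring
  have hnonneg := hform ▸ (le_iff.1 h).2 c
  norm_cast at hnonneg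
  refine le_of_sq_le_sq ?_ (by positivity)
  linarith [mul_pow C ‖Finsupp.linearCombination 𝕜 v c‖ 2]

theorem denseRange_linearCombination (hv : Dense (Submodule.span 𝕜 (Set.range v) : Set E)) :
    DenseRange (Finsupp.linearCombination 𝕜 v) := by
  rwa [← Finsupp.range_linearCombination] at hv

theorem eq_of_forall_inner_eq (hv : Dense (Submodule.span 𝕜 (Set.range v) : Set E)) {f g : E}
    (h : ∀ x, ⟪v x, f⟫_𝕜 = ⟪v x, g⟫_𝕜) : f = g := by
  refine hv.eq_of_inner_right 𝕜 fun u hu => ?_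
  induction hu using Submodule.span_induction with
  | mem _ hx => obtain ⟨x, rfl⟩ := hx; exact h x
  | zero => simp
  | add _ _ _ _ h₁ h₂ => simp only [inner_add_left, h₁, h₂]
  | smul a _ _ ih => simp only [inner_smul_left, ih]

theorem exists_continuousLinearMap_of_gram_le [CompleteSpace F]
    (hv : Dense (Submodule.span 𝕜 (Set.range v) : Set E)) {C : ℝ} (hC : 0 ≤ C)
    (h : gram 𝕜 w ≤ C ^ 2 • gram 𝕜 v) :
    ∃ T : E →L[𝕜] F, (∀ x, T (v x) = w x) ∧ ‖T‖ ≤ C := by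
  have hdense := denseRange_linearCombination hv
  have hbound := norm_linearCombination_le_of_gram_le hC h
  refine ⟨(Finsupp.linearCombination 𝕜 w).extendOfNorm (Finsupp.linearCombination 𝕜 v),
    fun x => ?_, LinearMap.opNorm_extendOfNorm_le hdense hC hbound⟩
  simpa using LinearMap.extendOfNorm_eq hdense ⟨C, hbound⟩ (Finsupp.single x 1)

theorem exists_linearIsometryEquiv_of_gram_eq [CompleteSpace E] [CompleteSpace F]
    (hv : Dense (Submodule.span 𝕜 (Set.range v) : Set E))
    (hw : Dense (Submodule.span 𝕜 (Set.range w) : Set F)) (h : gram 𝕜 v = gram 𝕜 w) :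
    ∃ U : E ≃ₗᵢ[𝕜] F, ∀ x, U (v x) = w x := by
  have hnorm (c : X →₀ 𝕜) :
      ‖Finsupp.linearCombination 𝕜 w c‖ = ‖Finsupp.linearCombination 𝕜 v c‖ := by
    apply le_antisymm
    · simpa using norm_linearCombination_le_of_gram_le zero_le_one (by simp [h]) c
    · simpa using norm_linearCombination_le_of_gram_le zero_le_one (by simp [h]) c
  have hv' := denseRange_linearCombination hv
  have hw' := denseRange_linearCombination hw
  refine ⟨(LinearEquiv.refl 𝕜 (X →₀ 𝕜)).extendOfIsometry _ _ hv' hw' hnorm, fun x => ?_⟩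
  simpa using (LinearEquiv.refl 𝕜 (X →₀ 𝕜)).extendOfIsometry_eq _ _ hv' hw' hnorm
    (Finsupp.single x 1)

end GramMatrix

section HadamardProduct

open Matrix
open scoped ComplexOrder MatrixOrder

/-- The Hadamard (entrywise) product `⨀ i ∈ s, A i` of a finite family of matrices, iterating
`Matrix.hadamard`. -/
def hadamardProd {ι m n R : Type*} [CommMonoid R] (s : Finset ι) (A : ι → Matrix m n R) :
    Matrix m n R :=
  Matrix.of fun x y => ∏ i ∈ s, A i x y

theorem hadamardProd_apply {ι m n R : Type*} [CommMonoid R] (s : Finset ι) (A : ι → Matrix m n R)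
    (x : m) (y : n) : hadamardProd s A x y = ∏ i ∈ s, A i x y :=
  rfl

theorem hadamardProd_insert {ι m n R : Type*} [CommMonoid R] [DecidableEq ι] {s : Finset ι}
    {a : ι} (ha : a ∉ s) (A : ι → Matrix m n R) :
    hadamardProd (insert a s) A = A a ⊙ hadamardProd s A := by
  ext x y
  exact Finset.prod_insert ha

variable {ι X 𝕜 : Type*} [RCLike 𝕜]

theorem gram_prod (s : Finset ι) (F : ι → X → 𝕜) :
    gram 𝕜 (fun x => ∏ i ∈ s, F i x) = hadamardProd s fun i => gram 𝕜 (F i) := by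
  ext x y
  simp [hadamardProd_apply, Finset.prod_mul_distrib]

theorem hadamard_le_hadamard {A B P Q : Matrix X X 𝕜} (hAB : A ≤ B) (hPQ : P ≤ Q) (hP : 0 ≤ P)
    (hB : 0 ≤ B) : A ⊙ P ≤ B ⊙ Q := by
  have hsub : B ⊙ Q - A ⊙ P = (B - A) ⊙ P + B ⊙ (Q - P) := by
    ext x y
    simp only [Matrix.sub_apply, Matrix.add_apply, hadamard_apply]
    ring
  rw [le_iff, hsub]
  exact ((le_iff.1 hAB).hadamard (nonneg_iff_posSemidef.1 hP)).add
    ((nonneg_iff_posSemidef.1 hB).hadamard (le_iff.1 hPQ))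

theorem hadamardProd_nonneg {s : Finset ι} {A : ι → Matrix X X 𝕜} (hA : ∀ i ∈ s, 0 ≤ A i) :
    0 ≤ hadamardProd s A := by
  classical
  induction s using Finset.induction_on with
  | empty =>
    have hone : hadamardProd ∅ A = gram 𝕜 fun _ => (1 : 𝕜) := by
      ext x y
      simp [hadamardProd_apply]
    exact hone ▸ gram_nonneg _
  | insert a s ha ih =>
    rw [Finset.forall_mem_insert] at hA
    rw [hadamardProd_insert ha]
    exact (hA.1.posSemidef.hadamard (ih hA.2).posSemidef).nonneg

theorem hadamardProd_le_hadamardProd {s : Finset ι} {A B : ι → Matrix X X 𝕜}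
    (hA : ∀ i ∈ s, 0 ≤ A i) (hAB : ∀ i ∈ s, A i ≤ B i) :
    hadamardProd s A ≤ hadamardProd s B := by
  classical
  induction s using Finset.induction_on with
  | empty => rfl
  | insert a s ha ih =>
    rw [Finset.forall_mem_insert] at hA hAB
    rw [hadamardProd_insert ha, hadamardProd_insert ha]
    exact hadamard_le_hadamard hAB.1 (ih hA.2 hAB.2) (hadamardProd_nonneg hA.2)
      (hA.1.trans hAB.1)

end HadamardProduct

theorem continuousMultilinearMap_ext_of_dense_span {𝕜 ι G : Type*} {E X : ι → Type*} [Finite ι]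
    [CommSemiring 𝕜] [∀ i, AddCommMonoid (E i)] [∀ i, Module 𝕜 (E i)]
    [∀ i, TopologicalSpace (E i)] [AddCommMonoid G] [Module 𝕜 G] [TopologicalSpace G] [T2Space G]
    {v : ∀ i, X i → E i} (hv : ∀ i, Dense (Submodule.span 𝕜 (Set.range (v i)) : Set (E i)))
    {A B : ContinuousMultilinearMap 𝕜 E G}
    (h : ∀ x : ∀ i, X i, A (fun i => v i (x i)) = B fun i => v i (x i)) : A = B := by
  let S (i : ι) : Submodule 𝕜 (E i) := Submodule.span 𝕜 (Set.range (v i))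
  have hspan : A.toMultilinearMap.compLinearMap (fun i => (S i).subtype) =
      B.toMultilinearMap.compLinearMap fun i => (S i).subtype := by
    refine MultilinearMap.ext_of_span_eq_top
      (g := fun i x => (⟨v i x, Submodule.subset_span ⟨x, rfl⟩⟩ : S i)) (fun i => ?_) h
    convert Submodule.span_span_coe_preimage (R := 𝕜) (s := Set.range (v i))
    ext f
    simp [Subtype.ext_iff]
  have heqOn : Set.EqOn A B (Set.univ.pi fun i => (S i : Set (E i))) := fun f hf =>
    DFunLike.congr_fun hspan fun i => (⟨f i, hf i (Set.mem_univ i)⟩ : S i)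
  exact DFunLike.coe_injective
    (A.cont.ext_on (dense_pi Set.univ fun i _ => hv i) B.cont heqOn)

section TensorProduct

open Matrix
open scoped ComplexOrder MatrixOrder

variable {ι : Type*} [Fintype ι]

section Existence

variable {𝕜 Y G : Type*} {H : ι → Type*} [RCLike 𝕜]
  [∀ i, NormedAddCommGroup (H i)] [∀ i, InnerProductSpace 𝕜 (H i)]
  [NormedAddCommGroup G] [InnerProductSpace 𝕜 G] [CompleteSpace G]
  {v : ∀ i, Y → H i} {w : Y → G}

theorem exists_inner_eq_prod_inner (hw : Dense (Submodule.span 𝕜 (Set.range w) : Set G))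
    (hgram : gram 𝕜 w = hadamardProd Finset.univ fun i => gram 𝕜 (v i)) (f : ∀ i, H i) :
    ∃ g : G, (∀ y, ⟪w y, g⟫_𝕜 = ∏ i, ⟪v i y, f i⟫_𝕜) ∧ ‖g‖ ≤ ∏ i, ‖f i‖ := by
  have hle : gram 𝕜 (fun y => ∏ i, ⟪f i, v i y⟫_𝕜) ≤ (∏ i, ‖f i‖) ^ 2 • gram 𝕜 w := calc
    gram 𝕜 (fun y => ∏ i, ⟪f i, v i y⟫_𝕜)
      = hadamardProd Finset.univ fun i => gram 𝕜 fun y => ⟪f i, v i y⟫_𝕜 := gram_prod _ _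
    _ ≤ hadamardProd Finset.univ fun i => ‖f i‖ ^ 2 • gram 𝕜 (v i) :=
      hadamardProd_le_hadamardProd (fun i _ => gram_nonneg _) fun i _ => by
        have h := le_iff.2 (posSemidef_opNorm_smul_gram_sub_gram (v i) (innerSL 𝕜 (f i)))
        rwa [innerSL_apply_norm] at h
    _ = (∏ i, ‖f i‖) ^ 2 • gram 𝕜 w := by
      ext x y
      simp [hgram, hadamardProd_apply, RCLike.real_smul_eq_coe_mul, Finset.prod_mul_distrib,
        Finset.prod_pow]
  obtain ⟨T, hT, hT_norm⟩ := exists_continuousLinearMap_of_gram_le hw (by positivity) hle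
  refine ⟨(InnerProductSpace.toDual 𝕜 G).symm T, fun y => ?_, by simpa using hT_norm⟩
  rw [← inner_conj_symm, InnerProductSpace.toDual_symm_apply, hT, map_prod]
  simp only [inner_conj_symm]

theorem exists_continuousMultilinearMap_inner_eq_prod_inner
    (hw : Dense (Submodule.span 𝕜 (Set.range w) : Set G))
    (hgram : gram 𝕜 w = hadamardProd Finset.univ fun i => gram 𝕜 (v i)) :
    ∃ φ : ContinuousMultilinearMap 𝕜 H G, ∀ f y, ⟪w y, φ f⟫_𝕜 = ∏ i, ⟪v i y, f i⟫_𝕜 := by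
  choose φ hφ hφ_norm using exists_inner_eq_prod_inner hw hgram
  let P (y : Y) : MultilinearMap 𝕜 H 𝕜 :=
    (MultilinearMap.mkPiAlgebra 𝕜 ι 𝕜).compLinearMap fun i => innerₛₗ 𝕜 (v i y)
  have hP (f : ∀ i, H i) (y : Y) : ⟪w y, φ f⟫_𝕜 = P y f := by simp [P, hφ]
  have ext_inner {g₁ g₂ : G} (h : ∀ y, ⟪w y, g₁⟫_𝕜 = ⟪w y, g₂⟫_𝕜) : g₁ = g₂ :=
    eq_of_forall_inner_eq hw h
  let φₗ : MultilinearMap 𝕜 H G :=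
    { toFun := φ
      map_update_add' := fun f i a b => ext_inner fun y => by
        simp only [inner_add_right, hP, MultilinearMap.map_update_add]
      map_update_smul' := fun f i c a => ext_inner fun y => by
        simp only [inner_smul_right, hP, MultilinearMap.map_update_smul, smul_eq_mul] }
  exact ⟨φₗ.mkContinuous 1 fun f => by simpa [φₗ] using hφ_norm f, hφ⟩

end Existence

variable {G T : Type*} {H X : ι → Type*}
  [∀ i, NormedAddCommGroup (H i)] [∀ i, InnerProductSpace ℝ (H i)] [∀ i, CompleteSpace (H i)]
  [NormedAddCommGroup G] [InnerProductSpace ℝ G] [CompleteSpace G]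
  [NormedAddCommGroup T] [InnerProductSpace ℝ T] [CompleteSpace T]

theorem isHilbertTensorProduct_of_inner_eq_prod_inner {v : ∀ i, X i → H i} {w : (∀ i, X i) → G}
    (hv : ∀ i, Dense (Submodule.span ℝ (Set.range (v i)) : Set (H i)))
    (hw : Dense (Submodule.span ℝ (Set.range w) : Set G))
    (hgram : gram ℝ w = hadamardProd Finset.univ fun i => gram ℝ fun x => v i (x i))
    {φ : ContinuousMultilinearMap ℝ H G}
    (hφ : ∀ f x, ⟪w x, φ f⟫_ℝ = ∏ i, ⟪v i (x i), f i⟫_ℝ) :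
    IsHilbertTensorProduct φ.toMultilinearMap := by
  have hφv (x : ∀ i, X i) : φ (fun i => v i (x i)) = w x := by
    refine eq_of_forall_inner_eq hw fun y => ?_
    rw [hφ, ← gram_apply, hgram, hadamardProd_apply]
    rfl
  refine ⟨fun f g => ?_, hw.mono (Submodule.span_mono ?_)⟩
  · have hinner : (innerSL ℝ (φ f)).compContinuousMultilinearMap φ =
        (ContinuousMultilinearMap.mkPiAlgebra ℝ ι ℝ).compContinuousLinearMap
          fun i => innerSL ℝ (f i) := by
      refine continuousMultilinearMap_ext_of_dense_span hv fun x => ?_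
      simp [hφv, real_inner_comm, hφ]
    simpa using DFunLike.congr_fun hinner g
  · rintro _ ⟨x, rfl⟩
    exact ⟨_, hφv x⟩

theorem IsHilbertTensorProduct.exists_linearIsometryEquiv {φ : MultilinearMap ℝ H G}
    {ψ : MultilinearMap ℝ H T} (hφ : IsHilbertTensorProduct φ) (hψ : IsHilbertTensorProduct ψ) :
    ∃ U : T ≃ₗᵢ[ℝ] G, ∀ f, U (ψ f) = φ f := by
  refine exists_linearIsometryEquiv_of_gram_eq hψ.dense_span hφ.dense_span ?_
  ext f g
  simp only [gram_apply, hφ.inner_map_map, hψ.inner_map_map]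

end TensorProduct

theorem dense_span_range_kerFun_one (𝕜 : Type*) {X : Type*} (H : Type*) [RCLike 𝕜]
    [NormedAddCommGroup H] [InnerProductSpace 𝕜 H] [CompleteSpace H] [RKHS 𝕜 H X 𝕜] :
    Dense (Submodule.span 𝕜 (Set.range fun x : X => RKHS.kerFun H x (1 : 𝕜)) : Set H) := by
  rw [Submodule.dense_iff_topologicalClosure_eq_top, ← top_le_iff,
    ← RKHS.kerFun_dense (𝕜 := 𝕜) (H := H) (X := X) (V := 𝕜)]
  refine Submodule.topologicalClosure_mono (Submodule.span_le.2 ?_)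
  rintro _ ⟨x, a, rfl⟩
  have hsmul : RKHS.kerFun H x a = a • RKHS.kerFun H x (1 : 𝕜) := by simp [← map_smul]
  exact hsmul ▸ Submodule.smul_mem _ _ (Submodule.subset_span ⟨x, rfl⟩)

namespace PosSemidefKernel

section KernelFunctions

variable {X : Type*} (K : PosSemidefKernel X) (Ω : Set X)

/-- The kernel function `K (·, x)`, `x ∈ Ω`, as an element of the native space. Mathlib's
`RKHS.kerFun`, made for vector-valued functions, is evaluated at the scalar `1`. -/
noncomputable def kernelFun (x : Ω) : K.NativeSpace Ω :=
  RKHS.kerFun (K.NativeSpace Ω) x (1 : ℝ)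

variable {K Ω}

theorem inner_kernelFun (x : Ω) (f : K.NativeSpace Ω) : ⟪K.kernelFun Ω x, f⟫_ℝ = f x := by
  simp [kernelFun]

theorem inner_kernelFun_kernelFun (x y : Ω) :
    ⟪K.kernelFun Ω x, K.kernelFun Ω y⟫_ℝ = K.toFun x y := by
  rw [inner_kernelFun, kernelFun, RKHS.kerFun_apply, RKHS.OfKernel.kernel_ofKernel]
  simp [opMatrix, restrict]

variable (K Ω)

theorem dense_span_range_kernelFun :
    Dense (Submodule.span ℝ (Set.range (K.kernelFun Ω)) : Set (K.NativeSpace Ω)) :=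
  dense_span_range_kerFun_one ℝ (K.NativeSpace Ω)

end KernelFunctions

section Product

variable {ι : Type*} [Fintype ι] {X : ι → Type*} (K : ∀ i, PosSemidefKernel (X i))
  (Ω : ∀ i, Set (X i))

theorem gram_kernelFun_prod :
    Matrix.gram ℝ (fun x => (prod K).kernelFun (Set.univ.pi Ω) ((Equiv.Set.univPi Ω).symm x)) =
      hadamardProd Finset.univ fun i => Matrix.gram ℝ fun x => (K i).kernelFun (Ω i) (x i) := by
  ext x y
  simp only [Matrix.gram_apply, hadamardProd_apply, inner_kernelFun_kernelFun]
  rfl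

end Product

end PosSemidefKernel

theorem mainTheorem2_general {ι : Type*} [Fintype ι] {X : ι → Type*} (Ω : ∀ i, Set (X i))
    (K : ∀ i, PosSemidefKernel (X i)) :
    ∃ φ : MultilinearMap ℝ (fun i => (K i).NativeSpace (Ω i))
        ((PosSemidefKernel.prod K).NativeSpace (Set.univ.pi Ω)),
      (∀ (f : ∀ i, (K i).NativeSpace (Ω i)) (x : Set.univ.pi Ω),
        φ f x = ∏ i, f i ⟨x.1 i, x.2 i (Set.mem_univ i)⟩) ∧
      IsHilbertTensorProduct φ ∧
      ∀ (T : Type*) [NormedAddCommGroup T] [InnerProductSpace ℝ T] [CompleteSpace T]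
        (ψ : MultilinearMap ℝ (fun i => (K i).NativeSpace (Ω i)) T),
        IsHilbertTensorProduct ψ →
          ∃ U : T ≃ₗᵢ[ℝ] (PosSemidefKernel.prod K).NativeSpace (Set.univ.pi Ω),
            ∀ f, U (ψ f) = φ f := by
  have hgram := PosSemidefKernel.gram_kernelFun_prod K Ω
  have hdense := (PosSemidefKernel.prod K).dense_span_range_kernelFun (Set.univ.pi Ω)
  rw [← (Equiv.Set.univPi Ω).symm.surjective.range_comp] at hdense
  obtain ⟨φ, hφ⟩ := exists_continuousMultilinearMap_inner_eq_prod_inner hdense hgram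
  have hφ_tensor := isHilbertTensorProduct_of_inner_eq_prod_inner
    (fun i => (K i).dense_span_range_kernelFun (Ω i)) hdense hgram hφ
  refine ⟨φ.toMultilinearMap, fun f x => ?_, hφ_tensor,
    fun T _ _ _ ψ hψ => hφ_tensor.exists_linearIsometryEquiv hψ⟩
  have hφx := hφ f (Equiv.Set.univPi Ω x)
  simp only [Function.comp_apply, Equiv.symm_apply_apply, PosSemidefKernel.inner_kernelFun] at hφx
  exact hφx

theorem mainTheorem2 {M : ℕ} {d : Fin M → ℕ}
    (Ω : ∀ i, Set (EuclideanSpace ℝ (Fin (d i))))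
    (K : ∀ i, PosSemidefKernel (EuclideanSpace ℝ (Fin (d i)))) :
    ∃ φ : MultilinearMap ℝ (fun i => (K i).NativeSpace (Ω i))
        ((PosSemidefKernel.prod K).NativeSpace (Set.univ.pi Ω)),
      (∀ (f : ∀ i, (K i).NativeSpace (Ω i)) (x : Set.univ.pi Ω),
        φ f x = ∏ i, f i ⟨x.1 i, x.2 i (Set.mem_univ i)⟩) ∧
      IsHilbertTensorProduct φ ∧
      ∀ (T : Type*) [NormedAddCommGroup T] [InnerProductSpace ℝ T] [CompleteSpace T]
        (ψ : MultilinearMap ℝ (fun i => (K i).NativeSpace (Ω i)) T),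
        IsHilbertTensorProduct ψ →
          ∃ U : T ≃ₗᵢ[ℝ] (PosSemidefKernel.prod K).NativeSpace (Set.univ.pi Ω),
            ∀ f, U (ψ f) = φ f :=
  mainTheorem2_general Ω K
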